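/- **Setting.** Let $d_H$ be the normalized Hamming distance on $\{0,1\}^k$ (the fraction of coordinates in which two vectors differ). For distributions $D_1,D_2$ over $\{0,1\}^n$ let $d_{EM}(D_1,D_2)$ be the Earth Mover Distance: the minimum of $\sum_{X,Y} f_{XY}\,d_H(X,Y)$ over all $f\colon \{0,1\}^n\times\{0,1\}^n\to[0,1]$ with $\sum_Y f_{XY}=D_1(X)$ for all $X$ and $\sum_X f_{XY}=D_2(Y)$ for all $Y$. A property is a closed set $\mathcal P$ of distributions over $\{0,1\}^n$; $D$ is $\varepsilon$-far from a nonempty $\mathcal P$ if $\min_{D'\in\mathcal P} d_{EM}(D,D')>\varepsilon$. For a permutation $\sigma$ of $[n]$, $D_\sigma$ is the distribution with $D_\sigma(w_{\sigma(1)},\dots,w_{\sigma(n)})=D(w_1,\dots,w_n)$ for all $w$; $\mathcal P$ is index-invariant if, for all $D$ and $\sigma$, $D\in\mathcal P \iff D_\sigma\in\mathcal P$. $\mathcal P$ has VC-dimension at most $d$ if for every $D\in\mathcal P$ the support of $D$, as a set of vectors in $\{0,1\}^n$, has VC-dimension at most $d$. A non-adaptive $\varepsilon$-tester for $\mathcal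 P$ with $s$ samples and $q$ queries tosses coins, determines from them alone sets $J_1,\dots,J_s\subseteq[n]$ with $\sum_i |J_i|\le q$, draws $s$ independent samples $\mathbf V_1,\dots,\mathbf V_s$ from the unknown distribution $D$, reads $\mathbf V_i|_{J_i}$ for each $i$, and accepts or rejects as a function of the coins and of the bits read; it accepts with probability at least $2/3$ if $D\in\mathcal P$, and rejects with probability at least $2/3$ if $D$ is $\varepsilon$-far from $\mathcal P$. **Theorem.** There are absolute constants $c>0$, $C$ and $d_0\in\mathbb N$ such that for every $d\ge d_0$, with $k=2^d$ and $\ell=2^{2^{d-10}}$, there is a matrix $A\in\{0,1\}^{k\times \ell}$ with pairwise distinct rows, any two of whose distinct columns are at normalized Hamming distance at least $1/3$, such that the following holds for every positive multiple $n$ of $\ell$. Let $\mathbf V_1,\dots,\mathbf V_k\in\{0,1\}^n$ be the rows of $A$ with every bit repeated $n/\ell$ times consecutively, let $D_A$ be the uniform distribution on $\{\mathbf V_1,\dots,\mathbf V_k\}$, and let $$\mathcal P_{\mathsf{vc}}=\{(D_A)_\sigma : \sigma \text{ a permutation of } [n]\}.$$ Then $\mathcal P_{\mathsf{vc}}$ is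 a (closed) index-invariant property of VC-dimension at most $d$, and for every $\varepsilon\in(0,1/8]$ every non-adaptive $\varepsilon$-tester for $\mathcal P_{\mathsf{vc}}$ with $s$ samples and $q$ queries satisfies $$s\ \ge\ 2^{c d}\qquad\text{and}\qquad q\ \ge\ 2^{2^{d-C}}.$$ -/

import Mathlib

namespace HugeObject

noncomputable section

/-- The `n`-dimensional Hamming cube `{0,1}^n`. -/
abbrev Cube (n : ℕ) : Type := Fin n → Bool

/-- Probability distributions over `{0,1}^n`: functions `D : {0,1}^n → ℝ` with nonnegative values
summing to `1`, with the topology of a subset of a finite-dimensional real space. -/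
abbrev Dist (n : ℕ) : Type := stdSimplex ℝ (Cube n)

/-- The normalized Hamming distance: the fraction of coordinates in which two vectors differ. -/
def relHamming {k : ℕ} (x y : Fin k → Bool) : ℝ := (hammingDist x y : ℝ) / (k : ℝ)

/-- `f` is a feasible solution of the transport linear program between `D₁` and `D₂`. -/
structure IsTransport {n : ℕ} (D₁ D₂ : Dist n) (f : Cube n → Cube n → ℝ) : Prop where
  nonneg : ∀ x y, 0 ≤ f x y
  le_one : ∀ x y, f x y ≤ 1
  fst : ∀ x, ∑ y, f x y = D₁ x
  snd : ∀ y, ∑ x, f x y = D₂ y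

/-- The Earth Mover Distance with respect to the normalized Hamming distance: the value of the
minimization program over all transports. -/
def emd {n : ℕ} (D₁ D₂ : Dist n) : ℝ :=
  sInf {c : ℝ | ∃ f, IsTransport D₁ D₂ f ∧ c = ∑ x, ∑ y, f x y * relHamming x y}

/-- The distance of a distribution from a (nonempty) property: the least Earth Mover Distance
from `D` to a member of the property. -/
def distToProperty {n : ℕ} (D : Dist n) (P : Set (Dist n)) : ℝ :=
  sInf ((fun D' => emd D D') '' P)

/-- `D` is `ε`-far from the property `P`. -/
def IsFar {n : ℕ} (ε : ℝ) (D : Dist n) (P : Set (Dist n)) : Prop :=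
  ε < distToProperty D P

/-- The distribution `D_σ` obtained by permuting the indices, that is
`D_σ (w_{σ(1)}, …, w_{σ(n)}) = D (w_1, …, w_n)` for every vector `w`. -/
def permute {n : ℕ} (σ : Equiv.Perm (Fin n)) (D : Dist n) : Dist n :=
  stdSimplex.map (fun w : Cube n => w ∘ σ) D

/-- A property is index-invariant if membership is unchanged by permuting the indices. -/
def IndexInvariant {n : ℕ} (P : Set (Dist n)) : Prop :=
  ∀ (D : Dist n) (σ : Equiv.Perm (Fin n)), D ∈ P ↔ permute σ D ∈ P

/-- `V` shatters the index sequence `I`: the projection of `V` onto `I` is all of `{0,1}^k`. -/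
def Shatters {n k : ℕ} (V : Set (Cube n)) (I : Fin k → Fin n) : Prop :=
  (fun v : Cube n => v ∘ I) '' V = Set.univ

/-- The VC-dimension of a set of vectors: the largest length of a shattered index sequence.
(A shattered sequence has no repetitions, so its length is at most `n`.) -/
def vcDim {n : ℕ} (V : Set (Cube n)) : ℕ :=
  sSup {k : ℕ | ∃ I : Fin k → Fin n, Shatters V I}

/-- The support of a distribution. -/
def supp {n : ℕ} (D : Dist n) : Set (Cube n) := {x | 0 < D x}

/-- A property has VC-dimension at most `d` if the support of each of its members does. -/
def VCDimAtMost {n : ℕ} (d : ℕ) (P : Set (Dist n)) : Prop :=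
  ∀ D ∈ P, vcDim (supp D) ≤ d

/-- A non-adaptive randomized algorithm in the huge object model, with `s` samples and at most `q`
queries. It tosses coins; from the coins it determines sets `J_1, …, J_s` of indices with
`∑ |J_i| ≤ q`; it reads the coordinates of the `i`-th sample that lie in `J_i`; it then accepts
(`true`) or rejects (`false`) as a function of the coins and of the bits that it has read. -/
structure NonAdaptiveAlg (n s q : ℕ) where
  Coins : Type
  law : PMF Coins
  queries : Coins → Fin s → Finset (Fin n)
  sum_card_le : ∀ ω, ∑ i, (queries ω i).card ≤ q
  output : (ω : Coins) → ((i : Fin s) → {j : Fin n // j ∈ queries ω i} → Bool) → Bool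

/-- The probability, over the coins and over `s` independent samples from `D`, that the algorithm
outputs `b`. -/
def NonAdaptiveAlg.outputProb {n s q : ℕ} (T : NonAdaptiveAlg n s q) (D : Dist n) (b : Bool) : ℝ :=
  ∑' ω : T.Coins, (T.law ω).toReal *
    ∑ V : Fin s → Cube n,
      if T.output ω (fun i j => V i j.1) = b then ∏ i, D (V i) else 0

/-- The algorithm `ε`-tests the property `P` (with probability at least `2/3`). -/
def NonAdaptiveAlg.Tests {n s q : ℕ} (T : NonAdaptiveAlg n s q) (ε : ℝ) (P : Set (Dist n)) :
    Prop :=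
  (∀ D ∈ P, 2 / 3 ≤ T.outputProb D true) ∧
  (∀ D, IsFar ε D P → 2 / 3 ≤ T.outputProb D false)

/-- The blow-up of a vector of length `l` to length `l * m`: every bit is repeated `m` times in
consecutive positions (`Fin.divNat j` is the integer quotient of `j` by `m`). -/
def blowUp {l : ℕ} (m : ℕ) (a : Fin l → Bool) : Cube (l * m) := fun j => a j.divNat

/-- The distribution `D_A`: a uniformly random row of `A`, blown up `m` times. -/
def blowUpDist {d l : ℕ} (A : Matrix (Fin (2 ^ d)) (Fin l) Bool) (m : ℕ) : Dist (l * m) :=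
  stdSimplex.map (fun i => blowUp m (A i)) stdSimplex.barycenter

/-- The property of being obtained from `D_A` by a permutation of the indices. -/
def permProperty {d l : ℕ} (A : Matrix (Fin (2 ^ d)) (Fin l) Bool) (m : ℕ) : Set (Dist (l * m)) :=
  {D | ∃ σ : Equiv.Perm (Fin (l * m)), D = permute σ (blowUpDist A m)}

end

end HugeObject

open HugeObject

/-! A random matrix has pairwise `1/3`-far rows and columns: the weight `(1/2)^dist` of a pair has
mean `(3/4)^N`, where `N` is the length of the vectors, and this beats the number of pairs
(`exists_separated_matrix`).

Both lower bounds then come from one birthday argument. For samples, compare `D_A` with the uniform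
distribution on an eighth of the rows, each with weight `8/k`. For queries, compare shuffled copies
of `D_A` with shuffled matrices that use only an eighth of the columns, each `8m` times. After
uniformly random relabelling, the algorithm sees an injective choice of labels in both cases unless
two samples (or two queried positions) carry the same label, and all injective choices look alike
(`sum_perm_comp_sub_le`). The collision probabilities add up to at most `9 s²/k`, respectively `9
q²/ℓ`, while a tester needs an advantage of `1/3`.

The alternatives are far. Within distance `1/6` of a point of weight `8/k` there is at most one row
of `D'`, which absorbs an eighth of its mass, so the cost is at least `7/8 · 1/6 = 7/48 > 1/8`
(`le_emd_of_heavy_of_separated`). For columns, coordinates that agree in the source but are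
`1/3`-far in the target force movement on at least one of them, and `7/8` of the pairs in a class
are of this kind (`le_emd_of_coordinate_classes`). -/

namespace HugeObject

/-! ### Uniform distributions on the rows of a matrix -/

section Distributions

variable {ι : Type*} [Fintype ι] [Nonempty ι] {n : ℕ}

/-- The distribution of a uniformly random row of `B`. -/
noncomputable abbrev rowDist (B : ι → Cube n) : Dist n := stdSimplex.map B stdSimplex.barycenter

theorem rowDist_apply (B : ι → Cube n) (y : Cube n) :
    rowDist B y = ∑ i, if B i = y then (Fintype.card ι : ℝ)⁻¹ else 0 := by
  classical
  rw [stdSimplex.map_coe, FunOnFinite.linearMap_apply_apply, Finset.sum_filter]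
  rfl

theorem sum_rowDist_mul (B : ι → Cube n) (g : Cube n → ℝ) :
    ∑ y, rowDist B y * g y = (Fintype.card ι : ℝ)⁻¹ * ∑ i, g (B i) := by
  simp_rw [rowDist_apply, Finset.sum_mul, ite_mul, zero_mul]
  rw [Finset.sum_comm, Finset.mul_sum]
  simp

theorem permute_rowDist (σ : Equiv.Perm (Fin n)) (B : ι → Cube n) :
    permute σ (rowDist B) = rowDist (fun i => B i ∘ σ) := by
  rw [permute, stdSimplex.map_comp_apply]
  rfl

theorem rowDist_comp_perm (τ : Equiv.Perm ι) (B : ι → Cube n) :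
    rowDist (fun i => B (τ i)) = rowDist B := by
  refine stdSimplex.ext (funext fun y => ?_)
  rw [rowDist_apply, rowDist_apply]
  exact Equiv.sum_comp τ fun i => if B i = y then (Fintype.card ι : ℝ)⁻¹ else 0

theorem rowDist_pos_iff (B : ι → Cube n) (y : Cube n) : 0 < rowDist B y ↔ ∃ i, B i = y := by
  have hc : (0 : ℝ) < (Fintype.card ι : ℝ)⁻¹ := by
    have := Fintype.card_pos (α := ι)
    positivity
  rw [rowDist_apply, Finset.sum_pos_iff_of_nonneg fun i _ => by split_ifs <;> positivity]
  constructor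
  · rintro ⟨i, -, hi⟩
    refine ⟨i, by_contra fun h => ?_⟩
    simp [h] at hi
  · rintro ⟨i, hi⟩
    exact ⟨i, Finset.mem_univ _, by rwa [if_pos hi]⟩

theorem rowDist_le_of_injective {B : ι → Cube n} (hB : Function.Injective B) (y : Cube n) :
    rowDist B y ≤ (Fintype.card ι : ℝ)⁻¹ := by
  classical
  by_cases hy : ∃ i, B i = y
  · obtain ⟨i, rfl⟩ := hy
    simp [rowDist_apply, hB.eq_iff]
  · push Not at hy
    simp [rowDist_apply, hy]

/-- Sampling from `rowDist B` is sampling row indices uniformly and independently; this turns an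
acceptance probability into a count of index tuples. -/
theorem sum_mul_prod_rowDist {s : ℕ} (B : ι → Cube n) (F : (Fin s → Cube n) → ℝ) :
    ∑ V : Fin s → Cube n, F V * ∏ a, rowDist B (V a) =
      ((Fintype.card ι : ℝ)⁻¹) ^ s * ∑ I : Fin s → ι, F (fun a => B (I a)) := by
  classical
  simp_rw [rowDist_apply, Finset.prod_univ_sum, Finset.mul_sum, Fintype.piFinset_univ]
  rw [Finset.sum_comm]
  refine Finset.sum_congr rfl fun I _ => ?_
  rw [Finset.sum_eq_single fun a => B (I a)]
  · simp [mul_comm]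
  · intro V _ hV
    obtain ⟨a, ha⟩ := Function.ne_iff.mp hV
    rw [Finset.prod_eq_zero (Finset.mem_univ a), mul_zero]
    simp [Ne.symm ha]
  · simp

theorem vcDim_le_of_ncard_le {V : Set (Cube n)} {d : ℕ} (hV : V.ncard ≤ 2 ^ d) :
    vcDim V ≤ d := by
  refine csSup_le' ?_
  rintro k ⟨I, hI⟩
  have h1 : (Set.univ : Set (Fin k → Bool)).ncard ≤ V.ncard := by
    rw [← hI]
    exact Set.ncard_image_le V.toFinite
  rw [Set.ncard_univ, Nat.card_eq_fintype_card] at h1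
  simp only [Fintype.card_fun, Fintype.card_bool, Fintype.card_fin] at h1
  exact (Nat.pow_le_pow_iff_right (by norm_num)).mp (h1.trans hV)

theorem ncard_supp_rowDist_le (B : ι → Cube n) : (supp (rowDist B)).ncard ≤ Fintype.card ι := by
  have h : supp (rowDist B) = B '' Set.univ := by
    ext y
    rw [Set.image_univ]
    exact rowDist_pos_iff B y
  rw [h]
  refine (Set.ncard_image_le Set.finite_univ).trans ?_
  rw [Set.ncard_univ, Nat.card_eq_fintype_card]

end Distributions

/-! ### Lower bounds on the Earth Mover Distance -/

section EarthMover

variable {n : ℕ}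

theorem relHamming_eq_sum (x y : Cube n) :
    relHamming x y = (n : ℝ)⁻¹ * ∑ t, if x t ≠ y t then (1 : ℝ) else 0 := by
  rw [relHamming, hammingDist, Finset.sum_boole, div_eq_inv_mul]

theorem relHamming_nonneg (x y : Cube n) : 0 ≤ relHamming x y := by
  unfold relHamming
  positivity

theorem relHamming_comm (x y : Cube n) : relHamming x y = relHamming y x := by
  rw [relHamming, hammingDist_comm, relHamming]

theorem relHamming_triangle (x y z : Cube n) :
    relHamming x z ≤ relHamming x y + relHamming y z := by
  unfold relHamming
  rw [← add_div]
  gcongr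
  exact_mod_cast hammingDist_triangle x y z

theorem exists_isTransport (D₁ D₂ : Dist n) : ∃ f, IsTransport D₁ D₂ f := by
  refine ⟨fun x y => D₁ x * D₂ y, fun x y => ?_, fun x y => ?_, fun x => ?_, fun y => ?_⟩
  · exact mul_nonneg (stdSimplex.zero_le _ _) (stdSimplex.zero_le _ _)
  · exact mul_le_one₀ (stdSimplex.le_one _ _) (stdSimplex.zero_le _ _) (stdSimplex.le_one _ _)
  · rw [← Finset.mul_sum, stdSimplex.sum_eq_one, mul_one]
  · rw [← Finset.sum_mul, stdSimplex.sum_eq_one, one_mul]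

theorem le_emd {D₁ D₂ : Dist n} {r : ℝ}
    (h : ∀ f, IsTransport D₁ D₂ f → r ≤ ∑ x, ∑ y, f x y * relHamming x y) : r ≤ emd D₁ D₂ := by
  obtain ⟨f, hf⟩ := exists_isTransport D₁ D₂
  refine le_csInf ⟨_, f, hf, rfl⟩ ?_
  rintro _ ⟨g, hg, rfl⟩
  exact h g hg

theorem isFar_of_forall_le_emd {D : Dist n} {P : Set (Dist n)} {ε r : ℝ} (hP : P.Nonempty)
    (hε : ε < r) (h : ∀ D' ∈ P, r ≤ emd D D') : IsFar ε D P := by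
  refine hε.trans_le (le_csInf (hP.image _) ?_)
  rintro _ ⟨D', hD', rfl⟩
  exact h D' hD'

theorem IsTransport.le_snd {D₁ D₂ : Dist n} {f : Cube n → Cube n → ℝ} (hf : IsTransport D₁ D₂ f)
    (x y : Cube n) : f x y ≤ D₂ y := by
  rw [← hf.snd y]
  exact Finset.single_le_sum (f := fun x => f x y) (fun x _ => hf.nonneg x y) (Finset.mem_univ x)

theorem IsTransport.le_fst {D₁ D₂ : Dist n} {f : Cube n → Cube n → ℝ} (hf : IsTransport D₁ D₂ f)
    (x y : Cube n) : f x y ≤ D₁ x := by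
  rw [← hf.fst x]
  exact Finset.single_le_sum (fun y _ => hf.nonneg x y) (Finset.mem_univ y)

/-- A distribution concentrated on heavy points is far from one spread over light points that are
pairwise far apart. -/
theorem le_emd_of_heavy_of_separated {D₁ D₂ : Dist n} {p : ℝ}
    (h₁ : ∀ x, 0 < D₁ x → 8 * p ≤ D₁ x) (h₂ : ∀ y, D₂ y ≤ p)
    (hsep : ∀ y y', 0 < D₂ y → 0 < D₂ y' → y ≠ y' → 1 / 3 ≤ relHamming y y') :
    7 / 48 ≤ emd D₁ D₂ := by
  classical
  refine le_emd fun f hf => ?_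
  -- Two points of `D₂` within `1/6` of `x` would be less than `1/3` apart, so at most one target
  -- `y₀` is close, and it can receive at most `p ≤ D₁ x / 8`.
  have hclose : ∀ x, ∑ y, (if relHamming x y < 1 / 6 then f x y else 0) ≤ D₁ x / 8 := by
    intro x
    rcases (stdSimplex.zero_le D₁ x).eq_or_lt with h0 | h0
    · refine (Finset.sum_nonpos fun y _ => ?_).trans (by linarith)
      have := hf.le_fst x y
      split_ifs <;> linarith
    · by_cases hy : ∃ y₀, relHamming x y₀ < 1 / 6 ∧ 0 < D₂ y₀
      · obtain ⟨y₀, hy₀, hpos⟩ := hy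
        rw [Finset.sum_eq_single y₀]
        · rw [if_pos hy₀]
          linarith [hf.le_snd x y₀, h₂ y₀, h₁ x h0]
        · intro y _ hne
          split_ifs with hxy
          · refine le_antisymm ?_ (hf.nonneg x y)
            refine (hf.le_snd x y).trans (not_lt.mp fun hp => ?_)
            have := hsep y y₀ hp hpos hne
            have := relHamming_triangle y x y₀
            rw [relHamming_comm y x] at this
            linarith
          · rfl
        · simp
      · push Not at hy
        refine (Finset.sum_nonpos fun y _ => ?_).trans (by linarith)
        split_ifs with hxy
        · exact (hf.le_snd x y).trans (hy y hxy)
        · exact le_rfl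
  calc (7 / 48 : ℝ) = ∑ x, 1 / 6 * (D₁ x - D₁ x / 8) := by
        rw [← Finset.mul_sum, Finset.sum_sub_distrib, ← Finset.sum_div, stdSimplex.sum_eq_one]
        norm_num
    _ ≤ ∑ x, 1 / 6 * (∑ y, f x y - ∑ y, (if relHamming x y < 1 / 6 then f x y else 0)) := by
        gcongr with x
        · rw [hf.fst]
        · exact hclose x
    _ ≤ ∑ x, ∑ y, f x y * relHamming x y := by
        gcongr with x
        rw [← Finset.sum_sub_distrib, Finset.mul_sum]
        refine Finset.sum_le_sum fun y _ => ?_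
        have h0 := hf.nonneg x y
        split_ifs with h
        · have := mul_nonneg h0 (relHamming_nonneg x y)
          linarith
        · have := mul_le_mul_of_nonneg_left (not_lt.mp h) h0
          linarith

/-- If the coordinates fall into classes of size `8 m` on each of which all vectors of `D₁` are
constant, while a coordinate has at most `m` coordinates that are close to it under `D₂`, then the
distributions are far apart. -/
theorem le_emd_of_coordinate_classes {γ δ : Type*} [DecidableEq γ] [DecidableEq δ]
    {D₁ D₂ : Dist n} {m : ℕ} (hn : 0 < n) (hm : 0 < m) (b : Fin n → γ) (a : Fin n → δ)
    (hb : ∀ t, (Finset.univ.filter fun u => b u = b t).card = 8 * m)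
    (ha : ∀ t, (Finset.univ.filter fun u => a u = a t).card ≤ m)
    (h₁ : ∀ x, 0 < D₁ x → ∀ t u, b t = b u → x t = x u)
    (h₂ : ∀ t u, a t ≠ a u → 1 / 3 ≤ ∑ y, D₂ y * if y t ≠ y u then (1 : ℝ) else 0) :
    7 / 48 ≤ emd D₁ D₂ := by
  refine le_emd fun f hf => ?_
  -- `φ t` is the mass whose bit at `t` is changed by the transport; the cost is the average of `φ`.
  set φ : Fin n → ℝ := fun t => ∑ x, ∑ y, f x y * if x t ≠ y t then (1 : ℝ) else 0 with hφ
  have hcost : ∑ x, ∑ y, f x y * relHamming x y = (n : ℝ)⁻¹ * ∑ t, φ t := by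
    simp_rw [hφ, relHamming_eq_sum, Finset.mul_sum]
    symm
    rw [Finset.sum_comm]
    refine Finset.sum_congr rfl fun x _ => ?_
    rw [Finset.sum_comm]
    refine Finset.sum_congr rfl fun y _ => Finset.sum_congr rfl fun t _ => ?_
    ring
  have hφ0 : ∀ t, 0 ≤ φ t := fun t => Finset.sum_nonneg fun x _ => Finset.sum_nonneg fun y _ =>
    mul_nonneg (hf.nonneg x y) (by split_ifs <;> norm_num)
  -- Since `x t = x u` on the support of `D₁`, every arrival at a `y` with `y t ≠ y u` changes the
  -- bit at `t` or at `u`.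
  have hpair : ∀ t u, b u = b t → a u ≠ a t → 1 / 3 ≤ φ t + φ u := by
    intro t u hbt hat
    refine (h₂ u t hat).trans ?_
    simp_rw [← hf.snd, Finset.sum_mul]
    rw [Finset.sum_comm, hφ, ← Finset.sum_add_distrib]
    refine Finset.sum_le_sum fun x _ => ?_
    rw [← Finset.sum_add_distrib]
    refine Finset.sum_le_sum fun y _ => ?_
    have h0 := hf.nonneg x y
    rcases (stdSimplex.zero_le D₁ x).eq_or_lt with hx | hx
    · have : f x y = 0 := le_antisymm ((hf.le_fst x y).trans hx.symm.le) h0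
      simp [this]
    · rw [← mul_add]
      refine mul_le_mul_of_nonneg_left ?_ h0
      rw [h₁ x hx u t hbt]
      cases x t <;> cases y t <;> cases y u <;> norm_num
  have hterm : ∀ t, (7 * m : ℝ) / 3 ≤
      ∑ u ∈ Finset.univ.filter (fun u => b u = b t), (φ t + φ u) := by
    intro t
    have hcard : 7 * m ≤ ((Finset.univ.filter fun u => b u = b t).filter
        fun u => a u ≠ a t).card := by
      have h := Finset.card_filter_add_card_filter_not
        (s := Finset.univ.filter fun u => b u = b t) (fun u => a u = a t)
      rw [hb t] at h
      have h' : ((Finset.univ.filter fun u => b u = b t).filter fun u => a u = a t).card ≤ m :=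
        (Finset.card_le_card (Finset.filter_subset_filter _ (Finset.subset_univ _))).trans (ha t)
      simp only [ne_eq]
      omega
    calc (7 * m : ℝ) / 3 ≤ ∑ u ∈ (Finset.univ.filter fun u => b u = b t).filter
            (fun u => a u ≠ a t), (1 / 3 : ℝ) := by
          rw [Finset.sum_const, nsmul_eq_mul]
          have : ((7 * m : ℕ) : ℝ) ≤ _ := Nat.cast_le.mpr hcard
          push_cast at this ⊢
          linarith
      _ ≤ ∑ u ∈ (Finset.univ.filter fun u => b u = b t).filter
            (fun u => a u ≠ a t), (φ t + φ u) := by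
          refine Finset.sum_le_sum fun u hu => ?_
          simp only [Finset.mem_filter, Finset.mem_univ, true_and] at hu
          exact hpair t u hu.1 hu.2
      _ ≤ _ := Finset.sum_le_sum_of_subset_of_nonneg (Finset.filter_subset _ _)
          fun u _ _ => add_nonneg (hφ0 t) (hφ0 u)
  -- Each `φ t` is counted `8m` times as first and, by symmetry of the classes, `8m` times as second
  -- member of a pair.
  have hsum : ∑ t, ∑ u ∈ Finset.univ.filter (fun u => b u = b t), (φ t + φ u) =
      16 * m * ∑ t, φ t := by
    have e1 : ∑ t, ∑ u ∈ Finset.univ.filter (fun u => b u = b t), φ t = 8 * m * ∑ t, φ t := by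
      rw [Finset.mul_sum]
      refine Finset.sum_congr rfl fun t _ => ?_
      rw [Finset.sum_const, hb t, nsmul_eq_mul]
      push_cast
      ring
    have e2 : ∑ t, ∑ u ∈ Finset.univ.filter (fun u => b u = b t), φ u =
        ∑ t, ∑ u ∈ Finset.univ.filter (fun u => b u = b t), φ t := by
      simp_rw [Finset.sum_filter]
      rw [Finset.sum_comm]
      simp_rw [eq_comm]
    simp_rw [Finset.sum_add_distrib]
    rw [e2, e1]
    ring
  have hall : (n : ℝ) * (7 * m / 3) ≤ 16 * m * ∑ t, φ t := by
    rw [← hsum]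
    have := Finset.sum_le_sum fun t (_ : t ∈ Finset.univ) => hterm t
    simpa using this
  have hn' : (0 : ℝ) < n := by exact_mod_cast hn
  have hm' : (0 : ℝ) < m := by exact_mod_cast hm
  rw [hcost, inv_mul_eq_div, le_div_iff₀ hn']
  have : (m : ℝ) * (16 * ((7 / 48 : ℝ) * n)) ≤ m * (16 * ∑ t, φ t) := by linarith
  have := le_of_mul_le_mul_left this hm'
  linarith

end EarthMover

/-! ### Random relabelling and the birthday bound -/

section Symmetrization

open Finset

variable {α β Ω : Type*} [Fintype α] [Fintype β] [DecidableEq β] [Fintype Ω]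

/-- The bijection `f a ↦ g a` between the ranges extends to a permutation because `β` is finite. -/
theorem exists_perm_comp_eq {f g : α → β} (hf : Function.Injective f)
    (hg : Function.Injective g) : ∃ π : Equiv.Perm β, ∀ a, π (f a) = g a := by
  classical
  let e : Set.range f ≃ Set.range g :=
    (Equiv.ofInjective f hf).symm.trans (Equiv.ofInjective g hg)
  refine ⟨Equiv.extendSubtype (p := fun x => x ∈ Set.range f) (q := fun x => x ∈ Set.range g) e,
    fun a => ?_⟩
  rw [Equiv.extendSubtype_apply_of_mem _ _ ⟨a, rfl⟩]
  have h : (⟨f a, ⟨a, rfl⟩⟩ : Set.range f) = Equiv.ofInjective f hf a := rfl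
  rw [h]
  change ((Equiv.ofInjective g hg ((Equiv.ofInjective f hf).symm (Equiv.ofInjective f hf a)) :
    Set.range g) : β) = g a
  rw [Equiv.symm_apply_apply, Equiv.ofInjective_apply]

/-- Right translation by a permutation carrying `f` to `g` reindexes the sum. -/
theorem sum_perm_comp_eq_of_injective (G : (α → β) → ℝ) {f g : α → β}
    (hf : Function.Injective f) (hg : Function.Injective g) :
    ∑ τ : Equiv.Perm β, G (τ ∘ f) = ∑ τ : Equiv.Perm β, G (τ ∘ g) := by
  obtain ⟨π, hπ⟩ := exists_perm_comp_eq hf hg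
  rw [← Equiv.sum_comp (Equiv.mulRight π) fun τ : Equiv.Perm β => G (τ ∘ f)]
  refine sum_congr rfl fun τ _ => congrArg G (funext fun a => ?_)
  simp [hπ]

open scoped Classical in
/-- After composition with a uniformly random permutation of the values, two random functions can
only be told apart when one of them is not injective. -/
theorem sum_perm_comp_sub_le (G : (α → β) → ℝ) (h0 : ∀ f, 0 ≤ G f) (h1 : ∀ f, G f ≤ 1)
    (X Y : Ω → α → β) :
    ∑ ω, ∑ τ : Equiv.Perm β, (G (τ ∘ X ω) - G (τ ∘ Y ω)) ≤
      Fintype.card (Equiv.Perm β) * ((#{ω | ¬ Function.Injective (X ω)} : ℝ) +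
        #{ω | ¬ Function.Injective (Y ω)}) := by
  rw [← sum_boole, ← sum_boole, ← sum_add_distrib, mul_sum]
  refine sum_le_sum fun ω _ => ?_
  have hdiff : ∑ τ : Equiv.Perm β, (G (τ ∘ X ω) - G (τ ∘ Y ω)) ≤
      Fintype.card (Equiv.Perm β) := by
    refine (sum_le_sum (g := fun _ => (1 : ℝ)) fun τ _ => ?_).trans (by simp)
    linarith [h0 (τ ∘ Y ω), h1 (τ ∘ X ω)]
  have hc : (0 : ℝ) ≤ Fintype.card (Equiv.Perm β) := by positivity
  -- If both are injective the sums over `τ` cancel; otherwise a failed injectivity pays for the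
  -- trivial bound `hdiff`.
  by_cases hX : Function.Injective (X ω) <;> by_cases hY : Function.Injective (Y ω)
  · rw [sum_sub_distrib, sum_perm_comp_eq_of_injective G hX hY]
    simp [hX, hY]
  all_goals
    simp only [hX, hY, not_true_eq_false, not_false_eq_true, if_true, if_false]
    linarith

-- Union bound over ordered pairs, with denominators cleared: `M / N` bounds the collision
-- probability of one pair.
omit [Fintype β] in
open scoped Classical in
theorem card_not_injective_le {N M : ℕ} (X : Ω → α → β)
    (h : ∀ a b, a ≠ b → N * #{ω | X ω a = X ω b} ≤ M * Fintype.card Ω) :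
    N * #{ω | ¬ Function.Injective (X ω)} ≤ Fintype.card α ^ 2 * M * Fintype.card Ω := by
  have hsub : ({ω | ¬ Function.Injective (X ω)} : Finset Ω) ⊆
      (univ : Finset α).offDiag.biUnion fun p => {ω | X ω p.1 = X ω p.2} := by
    intro ω hω
    simp only [mem_filter, mem_univ, true_and, Function.Injective, not_forall] at hω
    obtain ⟨a, b, hab, hne⟩ := hω
    simp only [mem_biUnion, mem_offDiag, mem_univ, true_and, mem_filter]
    exact ⟨(a, b), hne, hab⟩
  calc N * #{ω | ¬ Function.Injective (X ω)}
      ≤ N * ∑ p ∈ (univ : Finset α).offDiag, #{ω | X ω p.1 = X ω p.2} :=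
        Nat.mul_le_mul_left _ ((card_le_card hsub).trans card_biUnion_le)
    _ ≤ ∑ p ∈ (univ : Finset α).offDiag, M * Fintype.card Ω := by
        rw [mul_sum]
        refine sum_le_sum fun p hp => h _ _ ?_
        simpa using hp
    _ ≤ Fintype.card α ^ 2 * M * Fintype.card Ω := by
        rw [sum_const, smul_eq_mul, offDiag_card, card_univ, mul_assoc, sq]
        exact Nat.mul_le_mul_right _ (Nat.sub_le _ _)

theorem sum_perm_comp_sub_le_of_collisions {N M M' : ℕ} (hN : 0 < N) (G : (α → β) → ℝ)
    (h0 : ∀ f, 0 ≤ G f) (h1 : ∀ f, G f ≤ 1) (X Y : Ω → α → β)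
    (hX : ∀ a b, a ≠ b → N * #{ω | X ω a = X ω b} ≤ M * Fintype.card Ω)
    (hY : ∀ a b, a ≠ b → N * #{ω | Y ω a = Y ω b} ≤ M' * Fintype.card Ω) :
    ∑ ω, ∑ τ : Equiv.Perm β, (G (τ ∘ X ω) - G (τ ∘ Y ω)) ≤
      (Fintype.card α : ℝ) ^ 2 * (M + M') / N * (Fintype.card Ω * Fintype.card (Equiv.Perm β)) := by
  classical
  refine (sum_perm_comp_sub_le G h0 h1 X Y).trans ?_
  have hx := card_not_injective_le (N := N) (M := M) X (by convert hX)
  have hy := card_not_injective_le (N := N) (M := M') Y (by convert hY)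
  have hN' : (0 : ℝ) < N := by exact_mod_cast hN
  have hx' : (N : ℝ) * (#{ω | ¬ Function.Injective (X ω)} : ℝ) ≤
      (Fintype.card α : ℝ) ^ 2 * M * Fintype.card Ω := by exact_mod_cast hx
  have hy' : (N : ℝ) * (#{ω | ¬ Function.Injective (Y ω)} : ℝ) ≤
      (Fintype.card α : ℝ) ^ 2 * M' * Fintype.card Ω := by exact_mod_cast hy
  rw [mul_comm, div_mul_eq_mul_div, le_div_iff₀ hN', ← mul_assoc, mul_right_comm]
  refine mul_le_mul_of_nonneg_right ?_ (by positivity)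
  linarith

end Symmetrization

/-! ### Collision probabilities -/

section Collisions

open Finset

/-- Two coordinates of a uniformly random function collide under a map with fibres of size at most
`M` with probability at most `M` over the number of values. -/
theorem card_fun_collision_le {α β γ : Type*} [Fintype α] [DecidableEq α] [Fintype β] [AddGroup β]
    [DecidableEq γ] (c : β → γ) {M : ℕ}
    (hM : ∀ x, #{y | c y = c x} ≤ M) {a b : α} (hab : a ≠ b) :
    Fintype.card β * #{I : α → β | c (I a) = c (I b)} ≤ M * Fintype.card (α → β) := by
  -- Translating the value at `a` is a bijection of the functions; averaging over `x` makes that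
  -- value uniform with `I b` held fixed.
  have hshift : ∀ x : β, #{I : α → β | c (I a) = c (I b)} =
      #{I : α → β | c (I a + x) = c (I b)} := by
    intro x
    let e : (α → β) ≃ (α → β) := Equiv.piCongrRight fun j =>
      if j = a then Equiv.addRight x else Equiv.refl β
    refine (card_equiv e fun I => ?_).symm
    simp [e, hab.symm]
  calc Fintype.card β * #{I : α → β | c (I a) = c (I b)}
      = ∑ x : β, #{I : α → β | c (I a + x) = c (I b)} := by
        rw [← sum_congr rfl fun x _ => hshift x, sum_const, smul_eq_mul, card_univ]
    _ = ∑ I : α → β, #{x : β | c (I a + x) = c (I b)} := by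
        simp_rw [card_filter]
        exact sum_comm
    _ ≤ ∑ I : α → β, M := by
        refine sum_le_sum fun I _ => ?_
        refine le_trans (le_of_eq ?_) (hM (I b))
        exact card_equiv (Equiv.addLeft (I a)) fun x => by simp
    _ = M * Fintype.card (α → β) := by
        rw [sum_const, smul_eq_mul, card_univ, mul_comm]

/-- Two distinct points collide, under a uniformly random permutation followed by a map with fibres
of size at most `M`, with probability at most `M` over the number of points. -/
theorem card_perm_collision_le {α γ : Type*} [Fintype α] [DecidableEq α] [DecidableEq γ]
    (c : α → γ) {M : ℕ} (hM : ∀ x, #{y | c y = c x} ≤ M) {a b : α} (hab : a ≠ b) :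
    Fintype.card α * #{σ : Equiv.Perm α | c (σ a) = c (σ b)} ≤
      M * Fintype.card (Equiv.Perm α) := by
  -- Precomposing with `swap b x` sends `b` to `σ x`; averaging over `x` makes this image uniform.
  have hswap : ∀ x : α, #{σ : Equiv.Perm α | c (σ a) = c (σ b)} =
      #{σ : Equiv.Perm α | c (σ (Equiv.swap b x a)) = c (σ x)} := by
    intro x
    refine (card_equiv (Equiv.mulRight (Equiv.swap b x)) fun σ => ?_).symm
    simp
  calc Fintype.card α * #{σ : Equiv.Perm α | c (σ a) = c (σ b)}
      = ∑ x : α, #{σ : Equiv.Perm α | c (σ (Equiv.swap b x a)) = c (σ x)} := by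
        rw [← sum_congr rfl fun x _ => hswap x, sum_const, smul_eq_mul, card_univ]
    _ = ∑ σ : Equiv.Perm α, #{x : α | c (σ (Equiv.swap b x a)) = c (σ x)} := by
        simp_rw [card_filter]
        exact sum_comm
    _ ≤ ∑ σ : Equiv.Perm α, M := by
        refine sum_le_sum fun σ _ => le_trans ?_ (hM (σ a))
        refine (card_le_card (t := {x : α | c (σ x) = c (σ a)}) fun x hx => ?_).trans
          (card_equiv σ fun x => by simp).le
        simp only [mem_filter, mem_univ, true_and] at hx ⊢
        -- For `x = a` the swap moves `a`, but `a` lies in its own fibre anyway.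
        by_cases hxa : x = a
        · rw [hxa]
        · rw [Equiv.swap_apply_of_ne_of_ne hab (Ne.symm hxa)] at hx
          exact hx.symm
    _ = M * Fintype.card (Equiv.Perm α) := by
        rw [sum_const, smul_eq_mul, card_univ, mul_comm]

end Collisions

/-! ### A random matrix with separated rows and columns -/

section SeparatedMatrix

open Finset

variable {ι κ : Type*} [Fintype ι] [DecidableEq ι] [Fintype κ] [DecidableEq κ]

theorem sum_half_pow_ne {j j' : κ} (hne : j ≠ j') :
    ∑ r : κ → Bool, (if r j ≠ r j' then (1 / 2 : ℝ) else 1) =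
      3 / 4 * Fintype.card (κ → Bool) := by
  -- Flipping bit `j` exchanges `r j = r j'` with `r j ≠ r j'`, so `r` and its flip together
  -- contribute `1 + 1/2`.
  let e : (κ → Bool) ≃ (κ → Bool) := Equiv.piCongrRight fun i =>
    if i = j then Equiv.boolNot else Equiv.refl Bool
  have h := Equiv.sum_comp e fun r : κ → Bool => (if r j ≠ r j' then (1 / 2 : ℝ) else 1)
  have hadd : ∑ r : κ → Bool, ((if r j ≠ r j' then (1 / 2 : ℝ) else 1) +
      (if e r j ≠ e r j' then (1 / 2 : ℝ) else 1)) = ∑ r : κ → Bool, (3 / 2 : ℝ) := by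
    refine sum_congr rfl fun r _ => ?_
    have h1 : e r j = !(r j) := by simp [e]
    have h2 : e r j' = r j' := by simp [e, hne.symm]
    rw [h1, h2]
    cases r j <;> cases r j' <;> norm_num
  rw [sum_add_distrib, h, sum_const, card_univ, nsmul_eq_mul] at hadd
  linarith

/-- The exponential moment of the distance of two columns of a uniformly random matrix. -/
theorem sum_half_pow_hammingDist_columns {j j' : κ} (hne : j ≠ j') :
    ∑ A : ι → κ → Bool, (1 / 2 : ℝ) ^ hammingDist (fun i => A i j) (fun i => A i j') =
      (3 / 4) ^ Fintype.card ι * Fintype.card (ι → κ → Bool) := by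
  have h : ∀ A : ι → κ → Bool, (1 / 2 : ℝ) ^ hammingDist (fun i => A i j) (fun i => A i j') =
      ∏ i, if A i j ≠ A i j' then (1 / 2 : ℝ) else 1 := by
    intro A
    rw [hammingDist, prod_ite, prod_const, prod_const_one, mul_one]
  simp_rw [h]
  have := prod_univ_sum (fun _ : ι => (univ : Finset (κ → Bool)))
    (fun _ r => if r j ≠ r j' then (1 / 2 : ℝ) else 1)
  rw [Fintype.piFinset_univ] at this
  rw [← this, prod_congr rfl fun _ _ => sum_half_pow_ne hne, prod_const, mul_pow, card_univ,
    Fintype.card_fun (α := ι), Nat.cast_pow]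

theorem sum_half_pow_hammingDist_rows {i i' : ι} (hne : i ≠ i') :
    ∑ A : ι → κ → Bool, (1 / 2 : ℝ) ^ hammingDist (A i) (A i') =
      (3 / 4) ^ Fintype.card κ * Fintype.card (ι → κ → Bool) := by
  have hcard : Fintype.card (κ → ι → Bool) = Fintype.card (ι → κ → Bool) :=
    Fintype.card_congr (Equiv.piComm fun (_ : κ) (_ : ι) => Bool)
  rw [← hcard, ← sum_half_pow_hammingDist_columns hne]
  exact (Equiv.sum_comp (Equiv.piComm fun (_ : κ) (_ : ι) => Bool)
    fun A : ι → κ → Bool => (1 / 2 : ℝ) ^ hammingDist (A i) (A i')).symm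

/-- First moment method: a bad pair contributes at least `1` to the total weight of its matrix,
while the average total weight is below `1`. The factors `x` and `y` set the distance thresholds. -/
theorem exists_matrix_half_pow_lt {x y : ℝ} (hx : 0 < x) (hy : 0 < y)
    (h : (Fintype.card κ : ℝ) ^ 2 * (3 / 4) ^ Fintype.card ι * x +
      (Fintype.card ι : ℝ) ^ 2 * (3 / 4) ^ Fintype.card κ * y < 1) :
    ∃ A : ι → κ → Bool,
      (∀ j j', j ≠ j' → (1 / 2 : ℝ) ^ hammingDist (fun i => A i j) (fun i => A i j') * x < 1) ∧
      ∀ i i', i ≠ i' → (1 / 2 : ℝ) ^ hammingDist (A i) (A i') * y < 1 := by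
  by_contra! hcon
  set N : ℝ := (Fintype.card (ι → κ → Bool) : ℝ) with hN
  have hNpos : 0 < N := by
    rw [hN]
    exact_mod_cast Fintype.card_pos
  have hone : ∀ A : ι → κ → Bool, (1 : ℝ) ≤
      (∑ p ∈ (univ : Finset κ).offDiag,
        (1 / 2 : ℝ) ^ hammingDist (fun i => A i p.1) (fun i => A i p.2) * x) +
      ∑ p ∈ (univ : Finset ι).offDiag, (1 / 2 : ℝ) ^ hammingDist (A p.1) (A p.2) * y := by
    intro A
    have n1 : 0 ≤ ∑ p ∈ (univ : Finset κ).offDiag,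
        (1 / 2 : ℝ) ^ hammingDist (fun i => A i p.1) (fun i => A i p.2) * x :=
      sum_nonneg fun _ _ => by positivity
    have n2 : 0 ≤ ∑ p ∈ (univ : Finset ι).offDiag,
        (1 / 2 : ℝ) ^ hammingDist (A p.1) (A p.2) * y :=
      sum_nonneg fun _ _ => by positivity
    by_cases hA : ∀ j j', j ≠ j' →
        (1 / 2 : ℝ) ^ hammingDist (fun i => A i j) (fun i => A i j') * x < 1
    · obtain ⟨i, i', hne, hi⟩ := hcon A hA
      have := single_le_sum (s := (univ : Finset ι).offDiag)
        (f := fun p => (1 / 2 : ℝ) ^ hammingDist (A p.1) (A p.2) * y)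
        (fun _ _ => by positivity) (a := (i, i')) (by simpa using hne)
      simp only at this
      linarith
    · push Not at hA
      obtain ⟨j, j', hne, hj⟩ := hA
      have := single_le_sum (s := (univ : Finset κ).offDiag)
        (f := fun p => (1 / 2 : ℝ) ^ hammingDist (fun i => A i p.1) (fun i => A i p.2) * x)
        (fun _ _ => by positivity) (a := (j, j')) (by simpa using hne)
      simp only at this
      linarith
  have hsum := sum_le_sum fun A (_ : A ∈ (univ : Finset (ι → κ → Bool))) => hone A
  rw [sum_const, card_univ, nsmul_eq_mul, mul_one, sum_add_distrib, sum_comm,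
    sum_comm (s := (univ : Finset (ι → κ → Bool))) (t := (univ : Finset ι).offDiag)] at hsum
  simp_rw [← sum_mul] at hsum
  have c1 : ∑ p ∈ (univ : Finset κ).offDiag, ∑ A : ι → κ → Bool,
      (1 / 2 : ℝ) ^ hammingDist (fun i => A i p.1) (fun i => A i p.2) ≤
      (Fintype.card κ : ℝ) ^ 2 * ((3 / 4) ^ Fintype.card ι * N) := by
    rw [sum_congr rfl fun p hp => sum_half_pow_hammingDist_columns (by simpa using hp), sum_const,
      nsmul_eq_mul, offDiag_card, card_univ, ← sq]
    refine mul_le_mul_of_nonneg_right ?_ (by positivity)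
    exact_mod_cast Nat.sub_le _ _
  have c2 : ∑ p ∈ (univ : Finset ι).offDiag, ∑ A : ι → κ → Bool,
      (1 / 2 : ℝ) ^ hammingDist (A p.1) (A p.2) ≤
      (Fintype.card ι : ℝ) ^ 2 * ((3 / 4) ^ Fintype.card κ * N) := by
    rw [sum_congr rfl fun p hp => sum_half_pow_hammingDist_rows (by simpa using hp), sum_const,
      nsmul_eq_mul, offDiag_card, card_univ, ← sq]
    refine mul_le_mul_of_nonneg_right ?_ (by positivity)
    exact_mod_cast Nat.sub_le _ _
  have := mul_le_mul_of_nonneg_right c1 hx.le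
  have := mul_le_mul_of_nonneg_right c2 hy.le
  have := mul_lt_mul_of_pos_right h hNpos
  linarith

theorem one_third_le_relHamming {N : ℕ} (hN : 0 < N) {x y : Cube N}
    (h : (1 / 2 : ℝ) ^ hammingDist x y * 2 ^ (N / 3) < 1) : 1 / 3 ≤ relHamming x y := by
  have h2 : N / 3 < hammingDist x y := by
    by_contra! hcon
    have h3 : (2 : ℝ) ^ hammingDist x y ≤ 2 ^ (N / 3) := pow_le_pow_right₀ (by norm_num) hcon
    have h4 : (1 / 2 : ℝ) ^ hammingDist x y * 2 ^ hammingDist x y = 1 := by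
      rw [← mul_pow]
      norm_num
    have := mul_le_mul_of_nonneg_left h3 (by positivity : (0 : ℝ) ≤ (1 / 2) ^ hammingDist x y)
    linarith
  have h3 : N ≤ 3 * hammingDist x y := by omega
  have h4 : (N : ℝ) ≤ 3 * hammingDist x y := by exact_mod_cast h3
  rw [relHamming, le_div_iff₀ (by exact_mod_cast hN)]
  linarith

/-- Three coordinates give `(3/4)^3 · 2 = 27/32`, and `(27/32)^5 < 1/2`, so every fifteen
coordinates gain a factor `1/2`. -/
theorem three_quarters_pow_mul_two_pow_le (N : ℕ) :
    (3 / 4 : ℝ) ^ N * 2 ^ (N / 3) ≤ (1 / 2) ^ (N / 15) := by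
  have h1 : (3 / 4 : ℝ) ^ N ≤ (3 / 4) ^ (3 * (N / 3)) :=
    pow_le_pow_of_le_one (by norm_num) (by norm_num) (Nat.mul_div_le N 3)
  have h2 : (27 / 32 : ℝ) ^ (N / 3) ≤ (27 / 32) ^ (5 * (N / 15)) :=
    pow_le_pow_of_le_one (by norm_num) (by norm_num) (by omega)
  calc (3 / 4 : ℝ) ^ N * 2 ^ (N / 3) ≤ (3 / 4) ^ (3 * (N / 3)) * 2 ^ (N / 3) := by gcongr
    _ = (27 / 32) ^ (N / 3) := by
        rw [pow_mul, ← mul_pow]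
        norm_num
    _ ≤ (27 / 32) ^ (5 * (N / 15)) := h2
    _ = ((27 / 32) ^ 5) ^ (N / 15) := by rw [pow_mul]
    _ ≤ (1 / 2) ^ (N / 15) := by
        gcongr
        norm_num

theorem two_pow_sq_mul_le {a N : ℕ} (h : 2 * a + 2 ≤ N / 15) :
    ((2 ^ a : ℕ) : ℝ) ^ 2 * (3 / 4) ^ N * 2 ^ (N / 3) ≤ 1 / 4 := by
  calc ((2 ^ a : ℕ) : ℝ) ^ 2 * (3 / 4) ^ N * 2 ^ (N / 3)
      = 2 ^ (2 * a) * ((3 / 4) ^ N * 2 ^ (N / 3)) := by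
        push_cast
        ring
    _ ≤ 2 ^ (2 * a) * (1 / 2) ^ (2 * a + 2) := by
        gcongr
        exact (three_quarters_pow_mul_two_pow_le N).trans
          (pow_le_pow_of_le_one (by norm_num) (by norm_num) h)
    _ = 1 / 4 := by
        rw [pow_add, ← mul_assoc, ← mul_pow]
        norm_num

/-- A matrix both of whose rows and whose columns are pairwise far apart. -/
theorem exists_separated_matrix {d : ℕ} (hd : 20 ≤ d) :
    ∃ A : Matrix (Fin (2 ^ d)) (Fin (2 ^ 2 ^ (d - 10))) Bool,
      (∀ j j', j ≠ j' → 1 / 3 ≤ relHamming (fun i => A i j) (fun i => A i j')) ∧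
      ∀ i i', i ≠ i' → 1 / 3 ≤ relHamming (A i) (A i') := by
  obtain ⟨e, rfl⟩ := Nat.exists_eq_add_of_le' (le_trans (by norm_num) hd : 10 ≤ d)
  rw [Nat.add_sub_cancel]
  have he : 10 ≤ e := by omega
  have hK : 2 * e < 2 ^ e := by
    induction e, he using Nat.le_induction with
    | base => norm_num
    | succ e he ih =>
      have := ih (by omega)
      rw [pow_succ]
      omega
  -- The gap `10` in the exponent is used here: `2^10 / 15` comfortably exceeds `2`, so the rows
  -- suffice to separate all pairs of `2^(2^e)` columns.
  have hk : 2 * 2 ^ e + 2 ≤ 2 ^ (e + 10) / 15 := by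
    rw [pow_add]
    omega
  have hl : 2 * (e + 10) + 2 ≤ 2 ^ 2 ^ e / 15 := by
    have h1 : 2 ^ (2 * e) ≤ 2 ^ 2 ^ e := Nat.pow_le_pow_right (by norm_num) hK.le
    have h2 : 2 ^ 10 ≤ 2 ^ e := Nat.pow_le_pow_right (by norm_num) he
    have h3 : 2 ^ 10 * (2 * e) ≤ 2 ^ e * 2 ^ e := Nat.mul_le_mul h2 hK.le
    rw [two_mul, pow_add] at h1
    omega
  obtain ⟨A, hcol, hrow⟩ := exists_matrix_half_pow_lt (ι := Fin (2 ^ (e + 10)))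
    (κ := Fin (2 ^ 2 ^ e)) (x := 2 ^ (2 ^ (e + 10) / 3)) (y := 2 ^ (2 ^ 2 ^ e / 3))
    (by positivity) (by positivity) (by
      rw [Fintype.card_fin, Fintype.card_fin]
      linarith [two_pow_sq_mul_le hk, two_pow_sq_mul_le hl])
  exact ⟨A, fun j j' h => one_third_le_relHamming (by positivity) (hcol j j' h),
    fun i i' h => one_third_le_relHamming (by positivity) (hrow i i' h)⟩

end SeparatedMatrix

/-! ### Acceptance probabilities and indistinguishability -/

section Testers

variable {n s q : ℕ}

/-- The probability that the algorithm outputs `b` when its coins show `ω`. -/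
noncomputable def NonAdaptiveAlg.condOutputProb (T : NonAdaptiveAlg n s q) (ω : T.Coins)
    (D : Dist n) (b : Bool) : ℝ :=
  ∑ V : Fin s → Cube n, if T.output ω (fun i j => V i j.1) = b then ∏ i, D (V i) else 0

theorem sum_prod_dist_eq_one (D : Dist n) : ∑ V : Fin s → Cube n, ∏ i, D (V i) = 1 := by
  classical
  have h := Finset.prod_univ_sum (fun _ : Fin s => (Finset.univ : Finset (Cube n)))
    (fun _ v => D v)
  rw [Fintype.piFinset_univ] at h
  rw [← h]
  simp only [stdSimplex.sum_eq_one, Finset.prod_const_one]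

namespace NonAdaptiveAlg

variable (T : NonAdaptiveAlg n s q) (ω : T.Coins) (D : Dist n)

theorem condOutputProb_nonneg (b : Bool) : 0 ≤ T.condOutputProb ω D b := by
  refine Finset.sum_nonneg fun V _ => ?_
  split_ifs
  · exact Finset.prod_nonneg fun i _ => stdSimplex.zero_le _ _
  · exact le_rfl

theorem condOutputProb_true_add_false :
    T.condOutputProb ω D true + T.condOutputProb ω D false = 1 := by
  rw [condOutputProb, condOutputProb, ← Finset.sum_add_distrib, ← sum_prod_dist_eq_one (s := s) D]
  refine Finset.sum_congr rfl fun V _ => ?_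
  cases T.output ω (fun i j => V i j.1) <;> simp

theorem condOutputProb_le_one (b : Bool) : T.condOutputProb ω D b ≤ 1 := by
  have h := T.condOutputProb_true_add_false ω D
  have h1 := T.condOutputProb_nonneg ω D true
  have h2 := T.condOutputProb_nonneg ω D false
  cases b <;> linarith

theorem hasSum_law : HasSum (fun ω => (T.law ω).toReal) 1 := by
  have hsum : Summable fun ω => (T.law ω).toReal :=
    ENNReal.summable_toReal (by rw [T.law.tsum_coe]; exact ENNReal.one_ne_top)
  have h := hsum.hasSum
  rwa [← ENNReal.tsum_toReal_eq fun ω => T.law.apply_ne_top ω, T.law.tsum_coe,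
    ENNReal.toReal_one] at h

theorem hasSum_outputProb (b : Bool) :
    HasSum (fun ω => (T.law ω).toReal * T.condOutputProb ω D b) (T.outputProb D b) := by
  refine (Summable.of_nonneg_of_le (fun ω => ?_) (fun ω => ?_) T.hasSum_law.summable).hasSum
  · exact mul_nonneg ENNReal.toReal_nonneg (T.condOutputProb_nonneg ω D b)
  · exact mul_le_of_le_one_right ENNReal.toReal_nonneg (T.condOutputProb_le_one ω D b)

theorem outputProb_true_add_false : T.outputProb D true + T.outputProb D false = 1 := by
  refine ((T.hasSum_outputProb D true).add (T.hasSum_outputProb D false)).unique ?_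
  simp_rw [← mul_add, T.condOutputProb_true_add_false, mul_one]
  exact T.hasSum_law

theorem condOutputProb_rowDist {ι : Type*} [Fintype ι] [Nonempty ι] (B : ι → Cube n) :
    T.condOutputProb ω (rowDist B) true = ((Fintype.card ι : ℝ)⁻¹) ^ s *
      ∑ I : Fin s → ι, if T.output ω (fun i j => B (I i) j.1) = true then (1 : ℝ) else 0 := by
  rw [← sum_mul_prod_rowDist B fun V : Fin s → Cube n =>
    if T.output ω (fun i j => V i j.1) = true then (1 : ℝ) else 0]
  simp_rw [ite_mul, one_mul, zero_mul]
  rfl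

variable {T}

/-- A tester separates, for some outcome of its coins, the average of any family of members of the
property from the average of any family of far distributions. -/
theorem Tests.one_third_le {ε δ : ℝ} {P : Set (Dist n)} (hT : T.Tests ε P) {Ω : Type*}
    [Fintype Ω] [Nonempty Ω] (D E : Ω → Dist n) (hD : ∀ x, D x ∈ P) (hE : ∀ x, IsFar ε (E x) P)
    (h : ∀ ω, ∑ x, (T.condOutputProb ω (D x) true - T.condOutputProb ω (E x) true) ≤
      δ * Fintype.card Ω) : 1 / 3 ≤ δ := by
  have hgap : (Fintype.card Ω : ℝ) * (1 / 3) ≤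
      ∑ x, (T.outputProb (D x) true - T.outputProb (E x) true) := by
    have := Finset.sum_le_sum fun x (_ : x ∈ Finset.univ) =>
      show (1 / 3 : ℝ) ≤ T.outputProb (D x) true - T.outputProb (E x) true by
        linarith [hT.1 (D x) (hD x), hT.2 (E x) (hE x), T.outputProb_true_add_false (E x)]
    simpa using this
  have hs := hasSum_sum fun x (_ : x ∈ Finset.univ) =>
    (T.hasSum_outputProb (D x) true).sub (T.hasSum_outputProb (E x) true)
  have hle := hasSum_le (fun ω => ?_) hs (T.hasSum_law.mul_right (δ * Fintype.card Ω))
  · have hc : (0 : ℝ) < Fintype.card Ω := by exact_mod_cast Fintype.card_pos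
    have : (Fintype.card Ω : ℝ) * (1 / 3) ≤ Fintype.card Ω * δ := by linarith
    exact le_of_mul_le_mul_left this hc
  · simp_rw [← mul_sub]
    rw [← Finset.mul_sum]
    exact mul_le_mul_of_nonneg_left (h ω) ENNReal.toReal_nonneg

/-- Few samples cannot tell all rows of a matrix from a random eighth of them. -/
theorem Tests.card_le_samples {ε : ℝ} {P : Set (Dist n)} (hT : T.Tests ε P) {k : ℕ} [NeZero k]
    (r : Fin k → Cube n) (h : Fin k → Fin k)
    (hh : ∀ i, (Finset.univ.filter fun i' => h i' = h i).card ≤ 8)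
    (hyes : ∀ τ : Equiv.Perm (Fin k), rowDist (fun i => r (τ i)) ∈ P)
    (hno : ∀ τ : Equiv.Perm (Fin k), IsFar ε (rowDist fun i => r (τ (h i))) P) :
    k ≤ 27 * s ^ 2 := by
  have hk : (0 : ℝ) < k := by exact_mod_cast Nat.pos_of_ne_zero (NeZero.ne k)
  -- The identity labelling has fibres of size `1`, the labelling `h` of size at most `8`.
  have key : 1 / 3 ≤ (s : ℝ) ^ 2 * (1 + 8) / k := by
    refine hT.one_third_le (fun τ : Equiv.Perm (Fin k) => rowDist (fun i => r (τ i)))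
      (fun τ => rowDist fun i => r (τ (h i))) hyes hno fun ω => ?_
    simp_rw [condOutputProb_rowDist, ← mul_sub, ← Finset.sum_sub_distrib]
    rw [← Finset.mul_sum, Finset.sum_comm]
    have := sum_perm_comp_sub_le_of_collisions (N := k) (M := 1) (M' := 8)
      (Nat.pos_of_ne_zero (NeZero.ne k))
      (fun f : Fin s → Fin k =>
        if T.output ω (fun i j => r (f i) j.1) = true then (1 : ℝ) else 0)
      (fun f => by split_ifs <;> norm_num) (fun f => by split_ifs <;> norm_num)
      (fun I : Fin s → Fin k => I) (fun I a => h (I a))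
      (fun a b hab => by
        have := card_fun_collision_le (α := Fin s) (β := Fin k) id (M := 1)
          (fun x => by simp [Finset.filter_eq']) hab
        simpa using this)
      (fun a b hab => by
        have := card_fun_collision_le (α := Fin s) (β := Fin k) h hh hab
        simpa using this)
    refine (mul_le_mul_of_nonneg_left this (by positivity)).trans (le_of_eq ?_)
    simp only [Fintype.card_fin, Fintype.card_fun, Nat.cast_pow, Nat.cast_one, Nat.cast_ofNat]
    rw [inv_pow]
    field_simp
  rw [le_div_iff₀ hk] at key
  have : (k : ℝ) ≤ 27 * (s : ℝ) ^ 2 := by linarith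
  exact_mod_cast this

/-- Few queries cannot tell two ways to distribute randomly chosen columns of a matrix over random
positions. -/
theorem Tests.card_le_queries {ε : ℝ} {P : Set (Dist n)} (hT : T.Tests ε P) (hn : 0 < n)
    {ι κ : Type*} [Fintype ι] [Nonempty ι] [Fintype κ] [DecidableEq κ] (A : ι → κ → Bool)
    (c c' : Fin n → κ) {M M' : ℕ}
    (hc : ∀ t, (Finset.univ.filter fun u => c u = c t).card ≤ M)
    (hc' : ∀ t, (Finset.univ.filter fun u => c' u = c' t).card ≤ M')
    (hyes : ∀ (σ : Equiv.Perm (Fin n)) (τ : Equiv.Perm κ),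
      rowDist (fun i t => A i (τ (c (σ t)))) ∈ P)
    (hno : ∀ (σ : Equiv.Perm (Fin n)) (τ : Equiv.Perm κ),
      IsFar ε (rowDist fun i t => A i (τ (c' (σ t)))) P) :
    n ≤ 3 * q ^ 2 * (M + M') := by
  have hn' : (0 : ℝ) < n := by exact_mod_cast hn
  have key : 1 / 3 ≤ (q : ℝ) ^ 2 * (M + M') / n := by
    refine hT.one_third_le
      (fun p : Equiv.Perm (Fin n) × Equiv.Perm κ => rowDist (fun i t => A i (p.2 (c (p.1 t)))))
      (fun p => rowDist fun i t => A i (p.2 (c' (p.1 t))))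
      (fun p => hyes p.1 p.2) (fun p => hno p.1 p.2) fun ω => ?_
    have hk : (Fintype.card ι : ℝ) ≠ 0 := by exact_mod_cast Fintype.card_ne_zero
    -- Non-adaptivity fixes all queried positions once the coins are known. Whatever rows `I` are
    -- sampled, the answers depend only on the column labels on `J`, which has at most `q` elements.
    set J : Finset (Fin n) := Finset.univ.biUnion (T.queries ω) with hJ
    have hmem : ∀ {i j}, j ∈ T.queries ω i → j ∈ J := fun {i j} hj =>
      Finset.mem_biUnion.mpr ⟨i, Finset.mem_univ _, hj⟩
    have hJq : (J.card : ℝ) ≤ q := by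
      exact_mod_cast Finset.card_biUnion_le.trans (T.sum_card_le ω)
    simp_rw [condOutputProb_rowDist, ← mul_sub, ← Finset.sum_sub_distrib]
    rw [← Finset.mul_sum, Finset.sum_comm]
    have hI : ∀ I : Fin s → ι, ∑ p : Equiv.Perm (Fin n) × Equiv.Perm κ,
        ((if T.output ω (fun i j => A (I i) (p.2 (c (p.1 j.1)))) = true then (1 : ℝ) else 0) -
          (if T.output ω (fun i j => A (I i) (p.2 (c' (p.1 j.1)))) = true then (1 : ℝ) else 0)) ≤
        (q : ℝ) ^ 2 * (M + M') / n * Fintype.card (Equiv.Perm (Fin n) × Equiv.Perm κ) := by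
      intro I
      rw [Fintype.sum_prod_type]
      refine (sum_perm_comp_sub_le_of_collisions (N := n) (M := M) (M' := M') hn
        (fun f : J → κ =>
          if T.output ω (fun i j => A (I i) (f ⟨j.1, hmem j.2⟩)) = true then (1 : ℝ) else 0)
        (fun f => by split_ifs <;> norm_num) (fun f => by split_ifs <;> norm_num)
        (fun (σ : Equiv.Perm (Fin n)) j => c (σ j)) (fun σ j => c' (σ j))
        (fun a b hab => ?_) (fun a b hab => ?_)).trans ?_
      · simpa using card_perm_collision_le c hc (fun h => hab (Subtype.ext h))
      · simpa using card_perm_collision_le c' hc' (fun h => hab (Subtype.ext h))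
      · rw [Fintype.card_prod, Nat.cast_mul, Fintype.card_coe]
        gcongr
    refine (mul_le_mul_of_nonneg_left (Finset.sum_le_sum fun I _ => hI I)
      (by positivity)).trans (le_of_eq ?_)
    rw [Finset.sum_const, Finset.card_univ, Fintype.card_fun, Fintype.card_fin, nsmul_eq_mul,
      Nat.cast_pow, inv_pow, inv_mul_cancel_left₀ (pow_ne_zero _ hk)]
  rw [le_div_iff₀ hn'] at key
  have : (n : ℝ) ≤ 3 * (q : ℝ) ^ 2 * (M + M') := by linarith
  exact_mod_cast this

end NonAdaptiveAlg

end Testers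

/-! ### Blow-ups and the permutation property -/

section BlowUp

variable {l m d : ℕ}

theorem card_filter_divNat_comp (σ : Equiv.Perm (Fin (l * m))) (p : Fin l → Prop)
    [DecidablePred p] :
    (Finset.univ.filter fun t => p (σ t).divNat).card = m * (Finset.univ.filter p).card := by
  have h := Finset.card_equiv (s := Finset.univ.filter fun t => p (σ t).divNat)
    (t := (Finset.univ.filter p) ×ˢ (Finset.univ : Finset (Fin m)))
    (σ.trans finProdFinEquiv.symm) fun t => by simp
  rw [h, Finset.card_product, Finset.card_univ, Fintype.card_fin, mul_comm]

theorem relHamming_blowUp_comp (hm : 0 < m) (σ : Equiv.Perm (Fin (l * m))) (a b : Fin l → Bool) :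
    relHamming (blowUp m a ∘ σ) (blowUp m b ∘ σ) = relHamming a b := by
  have h : hammingDist (blowUp m a ∘ σ) (blowUp m b ∘ σ) = m * hammingDist a b :=
    card_filter_divNat_comp σ fun j => a j ≠ b j
  have hm' : (m : ℝ) ≠ 0 := by exact_mod_cast hm.ne'
  rw [relHamming, relHamming, h]
  push_cast
  rw [mul_comm (l : ℝ), mul_div_mul_left _ _ hm']

/-- Permuting the blocks of a blow-up. -/
def blockPerm (m : ℕ) (τ : Equiv.Perm (Fin l)) : Equiv.Perm (Fin (l * m)) :=
  finProdFinEquiv.symm.trans ((τ.prodCongr (Equiv.refl _)).trans finProdFinEquiv)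

theorem divNat_blockPerm (τ : Equiv.Perm (Fin l)) (t : Fin (l * m)) :
    (blockPerm m τ t).divNat = τ t.divNat := by
  have h : (finProdFinEquiv.symm (blockPerm m τ t)).1 = τ (finProdFinEquiv.symm t).1 := by
    simp [blockPerm]
  simpa using h

/-- Composing labels with such a map keeps only an eighth of them; the factor `8` is what brings the
distance to `7/48 > 1/8`. -/
theorem exists_eight_to_one {N : ℕ} (hN : 8 ∣ N) :
    ∃ h : Fin N → Fin N, ∀ j, (Finset.univ.filter fun j' => h j' = h j).card = 8 := by
  obtain ⟨M, rfl⟩ := exists_eq_mul_left_of_dvd hN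
  refine ⟨fun j => finProdFinEquiv (j.divNat, 0), fun j => ?_⟩
  refine (congrArg Finset.card (Finset.filter_congr fun x _ => ?_)).trans
    ((card_filter_divNat_comp (Equiv.refl (Fin (M * 8))) fun i => i = j.divNat).trans ?_)
  · simp only [Equiv.refl_apply, EmbeddingLike.apply_eq_iff_eq, Prod.mk.injEq, and_true]
  · simp [Finset.filter_eq']

theorem mem_permProperty_iff {A : Matrix (Fin (2 ^ d)) (Fin l) Bool} {D : Dist (l * m)} :
    D ∈ permProperty A m ↔
      ∃ σ : Equiv.Perm (Fin (l * m)), D = rowDist fun i => blowUp m (A i) ∘ σ := by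
  simp only [permProperty, Set.mem_ofPred_eq, blowUpDist, permute_rowDist]

theorem permProperty_nonempty (A : Matrix (Fin (2 ^ d)) (Fin l) Bool) :
    (permProperty A m).Nonempty :=
  ⟨_, Equiv.refl _, rfl⟩

theorem isClosed_permProperty (A : Matrix (Fin (2 ^ d)) (Fin l) Bool) :
    IsClosed (permProperty A m) := by
  have h : permProperty A m = Set.range fun σ => permute σ (blowUpDist A m) := by
    ext D
    simp [permProperty, eq_comm]
  rw [h]
  exact (Set.finite_range _).isClosed

theorem permute_permute {n : ℕ} (σ σ' : Equiv.Perm (Fin n)) (D : Dist n) :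
    permute σ (permute σ' D) = permute (σ' * σ) D := by
  rw [permute, permute, stdSimplex.map_comp_apply]
  rfl

theorem permute_one {n : ℕ} (D : Dist n) : permute 1 D = D :=
  stdSimplex.map_id_apply D

theorem indexInvariant_permProperty (A : Matrix (Fin (2 ^ d)) (Fin l) Bool) :
    IndexInvariant (permProperty A m) := by
  intro D σ
  constructor
  · rintro ⟨σ', rfl⟩
    exact ⟨σ' * σ, permute_permute _ _ _⟩
  · rintro ⟨σ', h⟩
    refine ⟨σ' * σ⁻¹, ?_⟩
    rw [← permute_permute, ← h, permute_permute, mul_inv_cancel, permute_one]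

theorem vcDimAtMost_permProperty (A : Matrix (Fin (2 ^ d)) (Fin l) Bool) :
    VCDimAtMost d (permProperty A m) := by
  intro D hD
  obtain ⟨σ, rfl⟩ := mem_permProperty_iff.mp hD
  refine vcDim_le_of_ncard_le ((ncard_supp_rowDist_le _).trans ?_)
  rw [Fintype.card_fin]

end BlowUp

/-! ### Far instances and the two lower bounds -/

section LowerBounds

variable {l m d : ℕ} {A : Matrix (Fin (2 ^ d)) (Fin l) Bool}

theorem relHamming_self {n : ℕ} (x : Cube n) : relHamming x x = 0 := by
  simp [relHamming]

theorem injective_of_separated {n : ℕ} {ι : Type*} {B : ι → Cube n}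
    (hB : ∀ i i', i ≠ i' → 1 / 3 ≤ relHamming (B i) (B i')) : Function.Injective B := by
  intro i i' h
  by_contra hne
  have := hB i i' hne
  rw [h, relHamming_self] at this
  norm_num at this

theorem isFar_eighth_of_rows (hm : 0 < m)
    (hrow : ∀ i i', i ≠ i' → 1 / 3 ≤ relHamming (A i) (A i')) {h : Fin (2 ^ d) → Fin (2 ^ d)}
    (hh : ∀ i, (Finset.univ.filter fun i' => h i' = h i).card = 8) (f : Fin (2 ^ d) → Fin (2 ^ d))
    {ε : ℝ} (hε : ε ≤ 1 / 8) :
    IsFar ε (rowDist fun i => blowUp m (A (f (h i)))) (permProperty A m) := by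
  refine isFar_of_forall_le_emd (r := 7 / 48) (permProperty_nonempty A)
    (hε.trans_lt (by norm_num)) fun D' hD' => ?_
  obtain ⟨σ, rfl⟩ := mem_permProperty_iff.mp hD'
  have hsep : ∀ i i', i ≠ i' →
      1 / 3 ≤ relHamming (blowUp m (A i) ∘ σ) (blowUp m (A i') ∘ σ) := fun i i' hne => by
    rw [relHamming_blowUp_comp hm]
    exact hrow i i' hne
  refine le_emd_of_heavy_of_separated (p := (Fintype.card (Fin (2 ^ d)) : ℝ)⁻¹)
    (fun x hx => ?_) (rowDist_le_of_injective (injective_of_separated hsep)) ?_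
  · obtain ⟨i, rfl⟩ := (rowDist_pos_iff _ _).mp hx
    rw [rowDist_apply, ← Finset.sum_filter, Finset.sum_const, nsmul_eq_mul]
    refine mul_le_mul_of_nonneg_right ?_ (by positivity)
    rw [← Nat.cast_ofNat, Nat.cast_le, ← hh i]
    refine Finset.card_le_card fun i' hi' => ?_
    simp only [Finset.mem_filter, Finset.mem_univ, true_and] at hi' ⊢
    rw [hi']
  · intro y y' hy hy' hne
    obtain ⟨i, rfl⟩ := (rowDist_pos_iff _ _).mp hy
    obtain ⟨i', rfl⟩ := (rowDist_pos_iff _ _).mp hy'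
    exact hsep i i' fun hii => hne (by rw [hii])

theorem isFar_eighth_of_columns (hl : 0 < l) (hm : 0 < m)
    (hcol : ∀ j j', j ≠ j' → 1 / 3 ≤ relHamming (fun i => A i j) (fun i => A i j'))
    {h : Fin l → Fin l} (hh : ∀ j, (Finset.univ.filter fun j' => h j' = h j).card = 8)
    (f : Fin l → Fin l) (σ : Equiv.Perm (Fin (l * m))) {ε : ℝ} (hε : ε ≤ 1 / 8) :
    IsFar ε (rowDist fun i t => A i (f (h (σ t).divNat))) (permProperty A m) := by
  refine isFar_of_forall_le_emd (r := 7 / 48) (permProperty_nonempty A)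
    (hε.trans_lt (by norm_num)) fun D' hD' => ?_
  obtain ⟨σ', rfl⟩ := mem_permProperty_iff.mp hD'
  refine le_emd_of_coordinate_classes (Nat.mul_pos hl hm) hm (fun t => h (σ t).divNat)
    (fun t => (σ' t).divNat) (fun t => ?_) (fun t => ?_) ?_ ?_
  · rw [card_filter_divNat_comp σ fun j => h j = h (σ t).divNat, hh, mul_comm]
  · rw [card_filter_divNat_comp σ' fun j => j = (σ' t).divNat]
    simp [Finset.filter_eq']
  · intro x hx t u htu
    obtain ⟨i, rfl⟩ := (rowDist_pos_iff _ _).mp hx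
    simp only at htu ⊢
    rw [htu]
  · intro t u htu
    rw [sum_rowDist_mul]
    have := hcol _ _ htu
    rw [relHamming_eq_sum] at this
    rw [Fintype.card_fin]
    exact this

/-- If `s < x = 2^(K/4)`, then `x^4 ≤ 27 s² < 27 x²` gives `x² < 27`, whereas `K ≥ 10` gives `x² ≥
32`. -/
theorem two_rpow_quarter_le {K s : ℕ} (hK : 10 ≤ K) (h : 2 ^ K ≤ 27 * s ^ 2) :
    (2 : ℝ) ^ ((K : ℝ) / 4) ≤ s := by
  by_contra! hlt
  set x : ℝ := (2 : ℝ) ^ ((K : ℝ) / 4) with hx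
  have hx4 : x ^ 4 = 2 ^ K := by
    rw [hx, ← Real.rpow_natCast, ← Real.rpow_mul (by norm_num), ← Real.rpow_natCast]
    congr 1
    push_cast
    ring
  have h1 : (2 : ℝ) ^ K ≤ 27 * (s : ℝ) ^ 2 := by exact_mod_cast h
  have h2 : (2 : ℝ) ^ 10 ≤ 2 ^ K := pow_le_pow_right₀ (by norm_num) hK
  have h3 : (s : ℝ) ^ 2 < x ^ 2 := pow_lt_pow_left₀ hlt (by positivity) (by norm_num)
  nlinarith [sq_nonneg (x ^ 2 - 32)]

variable {s q : ℕ} {T : NonAdaptiveAlg (l * m) s q} {ε : ℝ}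

theorem two_pow_le_of_tests_permProperty (hd : 3 ≤ d) (hm : 0 < m)
    (hrow : ∀ i i', i ≠ i' → 1 / 3 ≤ relHamming (A i) (A i')) (hε : ε ≤ 1 / 8)
    (hT : T.Tests ε (permProperty A m)) : 2 ^ d ≤ 27 * s ^ 2 := by
  obtain ⟨h, hh⟩ := exists_eight_to_one (pow_dvd_pow 2 hd : 2 ^ 3 ∣ 2 ^ d)
  refine hT.card_le_samples (fun i => blowUp m (A i)) h (fun i => (hh i).le) (fun τ => ?_)
    fun τ => isFar_eighth_of_rows hm hrow hh τ hε
  -- Relabelling the rows does not change the distribution, so every instance of this family is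
  -- `D_A` itself.
  rw [rowDist_comp_perm τ fun i => blowUp m (A i)]
  exact mem_permProperty_iff.mpr ⟨Equiv.refl _, rfl⟩

theorem card_columns_le_of_tests_permProperty (hl : 0 < l) (hl8 : 8 ∣ l) (hm : 0 < m)
    (hcol : ∀ j j', j ≠ j' → 1 / 3 ≤ relHamming (fun i => A i j) (fun i => A i j'))
    (hε : ε ≤ 1 / 8) (hT : T.Tests ε (permProperty A m)) : l ≤ 27 * q ^ 2 := by
  obtain ⟨h, hh⟩ := exists_eight_to_one hl8
  have key : l * m ≤ 3 * q ^ 2 * (m + 8 * m) := by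
    refine hT.card_le_queries (Nat.mul_pos hl hm) A (fun t => t.divNat) (fun t => h t.divNat)
      (fun t => ?_) (fun t => ?_) (fun σ τ => ?_)
      fun σ τ => isFar_eighth_of_columns hl hm hcol hh τ σ hε
    · refine (card_filter_divNat_comp (Equiv.refl (Fin (l * m))) fun j => j = t.divNat).trans_le ?_
      simp [Finset.filter_eq']
    · refine (card_filter_divNat_comp (Equiv.refl (Fin (l * m)))
        fun j => h j = h t.divNat).trans_le ?_
      rw [hh, mul_comm]
    -- Relabelling the columns by `τ` amounts to permuting whole blocks, hence to a permutation of
    -- the coordinates.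
    · refine mem_permProperty_iff.mpr ⟨σ.trans (blockPerm m τ), congrArg rowDist ?_⟩
      funext i t
      simp only [blowUp, Function.comp_apply, Equiv.trans_apply, divNat_blockPerm]
  refine le_of_mul_le_mul_right ?_ hm
  linarith

end LowerBounds

end HugeObject

theorem theorem5p1 :
    ∃ c : ℝ, 0 < c ∧ ∃ C : ℝ, ∃ d₀ : ℕ, ∀ d : ℕ, d₀ ≤ d →
      -- one matrix, with distinct rows and pairwise (1/3)-far columns, serves all dimensions
      ∃ A : Matrix (Fin (2 ^ d)) (Fin (2 ^ 2 ^ (d - 10))) Bool,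
        Function.Injective A ∧
        (∀ j j', j ≠ j' → 1 / 3 ≤ relHamming (fun i => A i j) (fun i => A i j')) ∧
        -- the dimension is `n = ℓ * m`, where `ℓ = 2 ^ 2 ^ (d - 10)`
        ∀ m : ℕ, 0 < m →
          IsClosed (permProperty A m) ∧
          IndexInvariant (permProperty A m) ∧
          VCDimAtMost d (permProperty A m) ∧
          ∀ ε : ℝ, 0 < ε → ε ≤ 1 / 8 →
            ∀ (s q : ℕ) (T : NonAdaptiveAlg (2 ^ 2 ^ (d - 10) * m) s q),
              T.Tests ε (permProperty A m) →
                (2 : ℝ) ^ (c * (d : ℝ)) ≤ (s : ℝ) ∧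
                (2 : ℝ) ^ ((2 : ℝ) ^ ((d : ℝ) - C)) ≤ (q : ℝ) := by
  -- `1/4` absorbs the square and the constant `27`. In `C = 12`, `10` comes from `ℓ = 2^(2^(d-10))`
  -- and `2` from dividing the exponent `2^(d-10)` by `4`. The separated matrix needs `d ≥ 20`.
  refine ⟨1 / 4, by norm_num, 12, 20, fun d hd => ?_⟩
  obtain ⟨A, hcol, hrow⟩ := exists_separated_matrix hd
  refine ⟨A, injective_of_separated hrow, hcol, fun m hm => ⟨isClosed_permProperty A,
    indexInvariant_permProperty A, vcDimAtMost_permProperty A, fun ε _ hε s q T hT => ⟨?_, ?_⟩⟩⟩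
  · have h := two_rpow_quarter_le (by omega)
      (two_pow_le_of_tests_permProperty (by omega) hm hrow hε hT)
    rwa [one_div_mul_eq_div]
  · have hK : 2 ^ 10 ≤ 2 ^ (d - 10) := Nat.pow_le_pow_right (by norm_num) (by omega)
    have h8 : 8 ∣ 2 ^ 2 ^ (d - 10) := (pow_dvd_pow 2 (by omega) : 2 ^ 3 ∣ 2 ^ 2 ^ (d - 10))
    have h := two_rpow_quarter_le (by omega)
      (card_columns_le_of_tests_permProperty (by positivity) h8 hm hcol hε hT)
    have he : (2 : ℝ) ^ ((d : ℝ) - 12) = ((2 ^ (d - 10) : ℕ) : ℝ) / 4 := by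
      rw [show (d : ℝ) - 12 = ((d - 10 : ℕ) : ℝ) - (2 : ℕ) by
        rw [Nat.cast_sub (by omega)]
        push_cast
        ring, Real.rpow_sub (by norm_num), Real.rpow_natCast, Real.rpow_natCast]
      push_cast
      norm_num
    rwa [he]
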